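/- Let $R$ be a commutative ring with identity and let $C$ be a semidualizing $R$-module, i.e. $C$ admits a projective resolution by finitely generated projective modules, the homothety map $R\to\operatorname{Hom}_R(C,C)$ is an isomorphism, and $\operatorname{Ext}^{n}_R(C,C)=0$ for all $n\ge 1$. For a class $\mathcal X$ of $R$-modules let $\widetilde{\mathcal X}$ be the class of exact ($\mathbb Z$-indexed) complexes of $R$-modules all of whose cycle modules lie in $\mathcal X$. Let $\mathcal P$ be the class of projective $R$-modules, $\mathcal P_C$ the class of modules isomorphic to $C\otimes_R P$ with $P$ projective, and $\mathcal F_C$ the class of modules isomorphic to $C\otimes_R F$ with $F$ flat. A complex $X$ of $R$-modules is called $D_C$-projective if there is an exact sequence of complexes of $R$-modules $$\cdots\to P_1\xrightarrow{f_1}P_0\xrightarrow{f_0}Q_{-1}\xrightarrow{f_{-1}}Q_{-2}\to\cdots$$ with all $P_i\in\widetilde{\mathcal P}$ and all $Q_i\in\widetilde{\mathcal P_C}$, which remains exact after applying $\operatorname{Hom}(-,H)$ (the group of morphisms of complexes) for every $H\in\widetilde{\mathcal F_C}$, and such that $X\cong\operatorname{Im} f_0$. Then the class of $D_C$-projective complexes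 is closed under direct summands and direct sums: 1. if $X$ is $D_C$-projective and $X\cong A\oplus B$ for complexes $A,B$ of $R$-modules, then $A$ is $D_C$-projective; 2. if $(X_\lambda)_{\lambda\in\Lambda}$ is any family, indexed by a set $\Lambda$, of $D_C$-projective complexes, then $\bigoplus_{\lambda\in\Lambda}X_\lambda$ is $D_C$-projective. -/

import Mathlib

open CategoryTheory Limits
open scoped TensorProduct

universe u

namespace DingComplex

variable {R : Type u} [CommRing R]

/-- The category `Ch(R)` of (unbounded, homologically graded) complexes of `R`-modules
`⋯ ⟶ Xⁿ⁺¹ ⟶ Xⁿ ⟶ Xⁿ⁻¹ ⟶ ⋯`. -/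
abbrev Ch (R : Type u) [CommRing R] := ChainComplex (ModuleCat.{u} R) ℤ

/-- Semidualizing modules over a commutative ring. -/
structure IsSemidualizing (C : ModuleCat.{u} R) : Prop where
  /-- `C` admits a degreewise finite projective resolution. -/
  exists_resolution : ∃ P : ProjectiveResolution C, ∀ n, Module.Finite R (P.complex.X n)
  /-- The homothety map `R → Hom_R(C, C)`, `r ↦ (c ↦ r • c)`, is an isomorphism. -/
  homothety_bijective : Function.Bijective (LinearMap.lsmul R C)
  /-- `Ext_R^n(C, C) = 0` for `n ≥ 1`. -/
  ext_eq_zero : ∀ n : ℕ, 1 ≤ n → Subsingleton (Abelian.Ext C C n)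

/-- The class of projective modules. -/
def projectiveModules (R : Type u) [CommRing R] : ObjectProperty (ModuleCat.{u} R) :=
  fun M => Module.Projective R M

/-- The class of `C`-projective modules: those of the form `C ⊗ P` with `P` projective. -/
def cProjectiveModules (C : ModuleCat.{u} R) : ObjectProperty (ModuleCat.{u} R) :=
  fun M => ∃ P : ModuleCat.{u} R, Module.Projective R P ∧ Nonempty (M ≃ₗ[R] C ⊗[R] P)

/-- The class of `C`-flat modules: those of the form `C ⊗ F` with `F` flat. -/
def cFlatModules (C : ModuleCat.{u} R) : ObjectProperty (ModuleCat.{u} R) :=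
  fun M => ∃ F : ModuleCat.{u} R, Module.Flat R F ∧ Nonempty (M ≃ₗ[R] C ⊗[R] F)

/-- For a class `𝒳` of modules, the class of `𝒳`-complexes: the exact complexes all of whose
cycle modules belong to `𝒳`. -/
def tilde (𝒳 : ObjectProperty (ModuleCat.{u} R)) : ObjectProperty (Ch R) :=
  fun X => X.Acyclic ∧ ∀ i : ℤ, 𝒳 (X.cycles i)

/-- A sequence `E` in a preadditive category is `Hom(-, 𝓑)`-exact if for every `B` in `𝓑` the
sequence of abelian groups `⋯ ⟶ Hom(Eᵢ₋₁, B) ⟶ Hom(Eᵢ, B) ⟶ Hom(Eᵢ₊₁, B) ⟶ ⋯` is exact. -/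
def IsHomExact {A : Type*} [Category* A] [Preadditive A] (𝓑 : ObjectProperty A)
    (E : ChainComplex A ℤ) : Prop :=
  ∀ B : A, 𝓑 B → ∀ i : ℤ, Function.Exact
    (fun g : E.X (i - 1) ⟶ B => E.d i (i - 1) ≫ g)
    (fun g : E.X i ⟶ B => E.d (i + 1) i ≫ g)

/-- `D_C`-projective complexes. In the exact sequence of complexes `E`, the terms of index `i ≥ 0`
are the `Pᵢ`, those of index `i < 0` are the `Qᵢ`, and `E.d 0 (-1)` is `f₀ : P₀ ⟶ Q₋₁`. -/
def IsDCProjective (C : ModuleCat.{u} R) : ObjectProperty (Ch R) :=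
  fun X => ∃ E : ChainComplex (Ch R) ℤ,
    E.Acyclic ∧
    IsHomExact (tilde (cFlatModules C)) E ∧
    (∀ i : ℤ, 0 ≤ i → tilde (projectiveModules R) (E.X i)) ∧
    (∀ i : ℤ, i < 0 → tilde (cProjectiveModules C) (E.X i)) ∧
    Nonempty (X ≅ image (E.d 0 (-1)))

end DingComplex

namespace DingComplex

/-! ### Relative resolutions and coresolutions: horseshoe lemmas, extensions, direct summands. -/

section Abelian

variable {A : Type*} [Category* A] [Abelian A]

/-- The sequence `0 ⟶ X ⟶ Y ⟶ Z ⟶ 0` is exact. -/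
structure IsShortExact {X Y Z : A} (f : X ⟶ Y) (g : Y ⟶ Z) : Prop where
  zero : f ≫ g = 0
  shortExact : (ShortComplex.mk f g zero).ShortExact

namespace IsShortExact

variable {X Y Z : A} {f : X ⟶ Y} {g : Y ⟶ Z}

lemma mono (h : IsShortExact f g) : Mono f := h.shortExact.mono_f

lemma epi (h : IsShortExact f g) : Epi g := h.shortExact.epi_g

lemma exists_lift (h : IsShortExact f g) {T : A} (t : T ⟶ Y) (ht : t ≫ g = 0) :
    ∃ s, s ≫ f = t :=
  have := h.mono
  ⟨h.shortExact.exact.lift t ht, h.shortExact.exact.lift_f t ht⟩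

lemma exists_desc (h : IsShortExact f g) {T : A} (t : Y ⟶ T) (ht : f ≫ t = 0) :
    ∃ s, g ≫ s = t :=
  have := h.epi
  ⟨h.shortExact.exact.desc t ht, h.shortExact.exact.g_desc t ht⟩

lemma of_desc (w : f ≫ g = 0) (hf : Mono f) (hg : Epi g)
    (hd : ∀ {T : A} (t : Y ⟶ T), f ≫ t = 0 → ∃ s, g ≫ s = t) : IsShortExact f g where
  zero := w
  shortExact := by
    refine .mk' (ShortComplex.exact_of_g_is_cokernel _ ?_) hf hg
    exact CokernelCofork.IsColimit.ofπ' g w fun t ht => ⟨(hd t ht).choose, (hd t ht).choose_spec⟩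

lemma of_lift (w : f ≫ g = 0) (hf : Mono f) (hg : Epi g)
    (hl : ∀ {T : A} (t : T ⟶ Y), t ≫ g = 0 → ∃ s, s ≫ f = t) : IsShortExact f g where
  zero := w
  shortExact := by
    refine .mk' (ShortComplex.exact_of_f_is_kernel _ ?_) hf hg
    exact KernelFork.IsLimit.ofι' f w fun t ht => ⟨(hl t ht).choose, (hl t ht).choose_spec⟩

lemma exists_cokernel (f : X ⟶ Y) [Mono f] : ∃ (Z : A) (g : Y ⟶ Z), IsShortExact f g :=
  ⟨_, _, .of_desc (cokernel.condition f) inferInstance inferInstance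
    fun t ht => ⟨cokernel.desc f t ht, cokernel.π_desc f t ht⟩⟩

lemma exists_kernel (g : Y ⟶ Z) [Epi g] : ∃ (X : A) (f : X ⟶ Y), IsShortExact f g :=
  ⟨_, _, .of_lift (kernel.condition g) inferInstance inferInstance
    fun t ht => ⟨kernel.lift g t ht, kernel.lift_ι g t ht⟩⟩

/-- Isomorphic outer terms may be substituted. -/
lemma of_iso {X' Z' : A} (h : IsShortExact f g) (e : X' ≅ X) (e' : Z ≅ Z') :
    IsShortExact (e.hom ≫ f) (g ≫ e'.hom) :=
  have := h.mono
  have := h.epi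
  .of_desc (by simp [reassoc_of% h.zero]) inferInstance inferInstance fun t ht => by
    obtain ⟨s, hs⟩ := h.exists_desc t (by simpa using ht)
    exact ⟨e'.inv ≫ s, by simpa using hs⟩

end IsShortExact

variable (𝓟 𝓠 𝓗 : ObjectProperty A)

/-- The sequence `0 ⟶ X ⟶ Y ⟶ Z ⟶ 0` is exact and `Hom(-, 𝓗)`-exact. -/
structure IsAdmissible {X Y Z : A} (f : X ⟶ Y) (g : Y ⟶ Z) : Prop extends IsShortExact f g where
  exists_extension : ∀ {H : A}, 𝓗 H → ∀ h : X ⟶ H, ∃ k : Y ⟶ H, f ≫ k = h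

/-- `X` has an exact and `Hom(-, 𝓗)`-exact coresolution `0 ⟶ X ⟶ Q₀ ⟶ Q₁ ⟶ ⋯` with terms
in `𝓠`. -/
def IsCoresolved : ObjectProperty A := fun X =>
  ∃ 𝓖 : ObjectProperty A, 𝓖 X ∧ ∀ Y, 𝓖 Y → ∃ (Q Z : A) (f : Y ⟶ Q) (g : Q ⟶ Z),
    𝓠 Q ∧ 𝓖 Z ∧ IsAdmissible 𝓗 f g

/-- `X` has an exact and `Hom(-, 𝓗)`-exact resolution `⋯ ⟶ P₁ ⟶ P₀ ⟶ X ⟶ 0` with terms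
in `𝓟`. -/
def IsResolved : ObjectProperty A := fun X =>
  ∃ 𝓖 : ObjectProperty A, 𝓖 X ∧ ∀ Y, 𝓖 Y → ∃ (P K : A) (f : K ⟶ P) (g : P ⟶ Y),
    𝓟 P ∧ 𝓖 K ∧ IsAdmissible 𝓗 f g

variable {𝓟 𝓠 𝓗}

lemma IsAdmissible.of_iso {X Y Z X' Z' : A} {f : X ⟶ Y} {g : Y ⟶ Z} (h : IsAdmissible 𝓗 f g)
    (e : X' ≅ X) (e' : Z ≅ Z') : IsAdmissible 𝓗 (e.hom ≫ f) (g ≫ e'.hom) where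
  toIsShortExact := h.toIsShortExact.of_iso e e'
  exists_extension hH t := by
    obtain ⟨k, hk⟩ := h.exists_extension hH (e.inv ≫ t)
    exact ⟨k, by simp [hk]⟩

lemma IsCoresolved.exists_admissible {X : A} (h : IsCoresolved 𝓠 𝓗 X) :
    ∃ (Q Z : A) (f : X ⟶ Q) (g : Q ⟶ Z), 𝓠 Q ∧ IsCoresolved 𝓠 𝓗 Z ∧ IsAdmissible 𝓗 f g := by
  obtain ⟨𝓖, hX, h𝓖⟩ := h
  obtain ⟨Q, Z, f, g, hQ, hZ, hfg⟩ := h𝓖 X hX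
  exact ⟨Q, Z, f, g, hQ, ⟨𝓖, hZ, h𝓖⟩, hfg⟩

lemma IsResolved.exists_admissible {X : A} (h : IsResolved 𝓟 𝓗 X) :
    ∃ (P K : A) (f : K ⟶ P) (g : P ⟶ X), 𝓟 P ∧ IsResolved 𝓟 𝓗 K ∧ IsAdmissible 𝓗 f g := by
  obtain ⟨𝓖, hX, h𝓖⟩ := h
  obtain ⟨P, K, f, g, hP, hK, hfg⟩ := h𝓖 X hX
  exact ⟨P, K, f, g, hP, ⟨𝓖, hK, h𝓖⟩, hfg⟩

lemma IsCoresolved.of_iso {X Y : A} (h : IsCoresolved 𝓠 𝓗 X) (e : X ≅ Y) :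
    IsCoresolved 𝓠 𝓗 Y := by
  refine ⟨fun Z => ∃ W, IsCoresolved 𝓠 𝓗 W ∧ Nonempty (W ≅ Z), ⟨X, h, ⟨e⟩⟩, ?_⟩
  rintro Z ⟨W, hW, ⟨i⟩⟩
  obtain ⟨Q, V, f, g, hQ, hV, hfg⟩ := hW.exists_admissible
  exact ⟨Q, V, _, _, hQ, ⟨V, hV, ⟨Iso.refl _⟩⟩, hfg.of_iso i.symm (Iso.refl _)⟩

lemma IsResolved.of_iso {X Y : A} (h : IsResolved 𝓟 𝓗 X) (e : X ≅ Y) :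
    IsResolved 𝓟 𝓗 Y := by
  refine ⟨fun Z => ∃ W, IsResolved 𝓟 𝓗 W ∧ Nonempty (W ≅ Z), ⟨X, h, ⟨e⟩⟩, ?_⟩
  rintro Z ⟨W, hW, ⟨i⟩⟩
  obtain ⟨P, V, f, g, hP, hV, hfg⟩ := hW.exists_admissible
  exact ⟨P, V, _, _, hP, ⟨V, hV, ⟨Iso.refl _⟩⟩, hfg.of_iso (Iso.refl _) i⟩

/-- The horseshoe lemma for coresolutions. -/
lemma IsAdmissible.horseshoe {X Y Z X' Z' Q₁ Q₂ : A} {f : X ⟶ Y} {g : Y ⟶ Z}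
    (h : IsAdmissible 𝓗 f g) {a : X ⟶ Q₁} {p : Q₁ ⟶ X'} (ha : IsAdmissible 𝓗 a p)
    {c : Z ⟶ Q₂} {r : Q₂ ⟶ Z'} (hc : IsAdmissible 𝓗 c r) (hQ : 𝓗 Q₁) :
    ∃ (Y' : A) (b : Y ⟶ Q₁ ⊞ Q₂) (q : Q₁ ⊞ Q₂ ⟶ Y') (f' : X' ⟶ Y') (g' : Y' ⟶ Z'),
      IsAdmissible 𝓗 b q ∧ IsAdmissible 𝓗 f' g' := by
  have := h.epi
  have := ha.mono
  have := ha.epi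
  have := hc.mono
  have := hc.epi
  -- Injectivity of `Q₁` is replaced by `Hom(-, 𝓗)`-exactness of the given sequence, which is why
  -- `Q₁` must lie in 𝓗.
  obtain ⟨e, he⟩ := h.exists_extension hQ a
  let b : Y ⟶ Q₁ ⊞ Q₂ := biprod.lift e (g ≫ c)
  have hfb : f ≫ b = a ≫ biprod.inl := by
    ext <;> simp [b, he, reassoc_of% h.zero]
  have hb : Mono b := by
    refine Preadditive.mono_of_cancel_zero _ fun t ht => ?_
    have h1 : t ≫ e = 0 := by simpa [b] using ht =≫ biprod.fst
    have h2 : t ≫ g = 0 := by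
      rw [← cancel_mono c]; simpa [b] using ht =≫ biprod.snd
    obtain ⟨s, rfl⟩ := h.exists_lift t h2
    have : s = 0 := by rw [← cancel_mono a]; simpa [he] using h1
    simp [this]
  obtain ⟨Y', q, hbq⟩ := IsShortExact.exists_cokernel b
  obtain ⟨f', hf'⟩ := ha.exists_desc (biprod.inl ≫ q) (by
    rw [← Category.assoc, ← hfb, Category.assoc, hbq.zero, comp_zero])
  obtain ⟨g', hg'⟩ := hbq.exists_desc (biprod.snd ≫ r) (by simp [b, hc.zero])
  have : Epi q := hbq.epi
  refine ⟨_, b, q, f', g', ⟨hbq, fun {H} hH t => ?_⟩, ⟨.of_desc ?_ ?_ ?_ ?_, fun {H} hH t => ?_⟩⟩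
  · obtain ⟨k, hk⟩ := ha.exists_extension hH (f ≫ t)
    obtain ⟨s, hs⟩ := h.exists_desc (t - e ≫ k) (by simp [reassoc_of% he, hk])
    obtain ⟨l, hl⟩ := hc.exists_extension hH s
    exact ⟨biprod.desc k l, by simp [b, hl, hs]⟩
  · rw [← cancel_epi p, reassoc_of% hf', hg']; simp
  -- Element chase: the pullback along the epimorphism `p` lifts a generalized element of `X'` to
  -- `Q₁`.
  · refine Preadditive.mono_of_cancel_zero _ fun t ht => ?_
    rw [← cancel_epi (pullback.snd p t), comp_zero]
    have h0 : (pullback.fst p t ≫ biprod.inl) ≫ q = 0 := by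
      rw [Category.assoc, ← hf', pullback.condition_assoc, ht, comp_zero]
    obtain ⟨y, hy⟩ := hbq.exists_lift _ h0
    have h1 : y ≫ e = pullback.fst p t := by simpa [b] using hy =≫ biprod.fst
    have h2 : y ≫ g = 0 := by
      rw [← cancel_mono c]; simpa [b] using hy =≫ biprod.snd
    obtain ⟨x, rfl⟩ := h.exists_lift y h2
    rw [← pullback.condition, ← h1, Category.assoc, Category.assoc, reassoc_of% he, ha.zero,
      comp_zero]
  · have : Epi (q ≫ g') := by rw [hg']; infer_instance
    exact epi_of_epi q g'
  · intro T t ht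
    have h1 : biprod.inl ≫ q ≫ t = 0 := by
      rw [← Category.assoc, ← hf', Category.assoc, ht, comp_zero]
    have h2 : c ≫ biprod.inr ≫ q ≫ t = 0 := by
      rw [← cancel_epi g, comp_zero]
      have := hbq.zero =≫ t
      have hb' : b = e ≫ biprod.inl + (g ≫ c) ≫ biprod.inr := by ext <;> simp [b]
      rw [hb'] at this
      simpa [h1] using this
    obtain ⟨s, hs⟩ := hc.exists_desc _ h2
    refine ⟨s, ?_⟩
    rw [← cancel_epi q, reassoc_of% hg', hs]
    ext <;> simp [h1]
  · obtain ⟨s, hs⟩ := h.exists_desc (e ≫ p ≫ t) (by simp [reassoc_of% he, reassoc_of% ha.zero])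
    obtain ⟨k, hk⟩ := hc.exists_extension hH s
    obtain ⟨l, hl⟩ := hbq.exists_desc (biprod.desc (p ≫ t) (-k)) (by simp [b, hk, hs])
    exact ⟨l, by rw [← cancel_epi p, reassoc_of% hf', hl]; simp⟩

/-- The horseshoe lemma for resolutions. -/
lemma IsShortExact.horseshoe {X Y Z X' Z' P₁ P₂ : A} {f : X ⟶ Y} {g : Y ⟶ Z}
    (h : IsShortExact f g) {a : X' ⟶ P₁} {p : P₁ ⟶ X} (ha : IsAdmissible 𝓗 a p)
    {c : Z' ⟶ P₂} {r : P₂ ⟶ Z} (hc : IsAdmissible 𝓗 c r) (hP : Projective P₂) :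
    ∃ (Y' : A) (b : Y' ⟶ P₁ ⊞ P₂) (q : P₁ ⊞ P₂ ⟶ Y) (f' : X' ⟶ Y') (g' : Y' ⟶ Z'),
      IsAdmissible 𝓗 b q ∧ IsShortExact f' g' := by
  have := h.epi
  have := h.mono
  have := ha.mono
  have := ha.epi
  have := hc.mono
  have := hc.epi
  let e : P₂ ⟶ Y := Projective.factorThru r g
  have he : e ≫ g = r := Projective.factorThru_comp r g
  let q : P₁ ⊞ P₂ ⟶ Y := biprod.desc (p ≫ f) e
  have hqg : q ≫ g = biprod.snd ≫ r := by ext <;> simp [q, he, h.zero]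
  have hq : Epi q := by
    refine Preadditive.epi_of_cancel_zero _ fun t ht => ?_
    have h1 : e ≫ t = 0 := by simpa [q] using biprod.inr ≫= ht
    have h2 : f ≫ t = 0 := by
      rw [← cancel_epi p]; simpa [q] using biprod.inl ≫= ht
    obtain ⟨s, rfl⟩ := h.exists_desc t h2
    have : s = 0 := by rw [← cancel_epi r]; simpa [reassoc_of% he] using h1
    simp [this]
  obtain ⟨Y', b, hbq⟩ := IsShortExact.exists_kernel q
  have : Mono b := hbq.mono
  obtain ⟨g', hg'⟩ := hc.exists_lift (b ≫ biprod.snd) (by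
    rw [Category.assoc, ← hqg, reassoc_of% hbq.zero, zero_comp])
  obtain ⟨f', hf'⟩ := hbq.exists_lift (a ≫ biprod.inl) (by simp [q, reassoc_of% ha.zero])
  have hex : IsShortExact f' g' := by
    refine .of_lift ?_ ?_ ?_ ?_
    · rw [← cancel_mono c, Category.assoc, hg', reassoc_of% hf']; simp
    · have : Mono (f' ≫ b) := by rw [hf']; infer_instance
      exact mono_of_mono f' b
    -- Dual chase: the pushout along the monomorphism `c` extends a test map from `Z'` to `P₂`.
    · refine Preadditive.epi_of_cancel_zero _ fun t ht => ?_
      rw [← cancel_mono (pushout.inr c t), zero_comp]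
      have h0 : b ≫ biprod.snd ≫ pushout.inl c t = 0 := by
        rw [← Category.assoc, ← hg', Category.assoc, pushout.condition, reassoc_of% ht, zero_comp]
      obtain ⟨y, hy⟩ := hbq.exists_desc _ h0
      have h1 : e ≫ y = pushout.inl c t := by simpa [q] using biprod.inr ≫= hy
      have h2 : f ≫ y = 0 := by
        rw [← cancel_epi p]; simpa [q] using biprod.inl ≫= hy
      obtain ⟨x, rfl⟩ := h.exists_desc y h2
      rw [← pushout.condition, ← h1, reassoc_of% he, reassoc_of% hc.zero, zero_comp]
    · intro T t ht
      have h1 : t ≫ b ≫ biprod.snd = 0 := by rw [← hg', reassoc_of% ht, zero_comp]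
      have h2 : (t ≫ b ≫ biprod.fst) ≫ p = 0 := by
        rw [← cancel_mono f, zero_comp]
        have := t ≫= hbq.zero
        have hb' : q = biprod.fst ≫ p ≫ f + biprod.snd ≫ e := by ext <;> simp [q]
        rw [hb'] at this
        simpa [reassoc_of% h1] using this
      obtain ⟨s, hs⟩ := ha.exists_lift _ h2
      refine ⟨s, ?_⟩
      rw [← cancel_mono b, Category.assoc, hf', reassoc_of% hs]
      ext <;> simp [h1]
  refine ⟨_, b, q, f', g', ⟨hbq, fun {H} hH t => ?_⟩, hex⟩
  obtain ⟨k, hk⟩ := ha.exists_extension hH (f' ≫ t)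
  obtain ⟨s, hs⟩ := hex.exists_desc (t - b ≫ biprod.fst ≫ k) (by simp [reassoc_of% hf', hk])
  obtain ⟨l, hl⟩ := hc.exists_extension hH s
  refine ⟨biprod.fst ≫ k + biprod.snd ≫ l, ?_⟩
  rw [Preadditive.comp_add, ← reassoc_of% hg', hl, hs]
  simp

/-- The horseshoe returns an admissible sequence of cokernels, so the middle terms of admissible
sequences with coresolved ends form a suitable 𝓖. -/
lemma IsCoresolved.of_isAdmissible (h𝓠𝓗 : 𝓠 ≤ 𝓗)
    (h𝓠 : ∀ Q₁ Q₂, 𝓠 Q₁ → 𝓠 Q₂ → 𝓠 (Q₁ ⊞ Q₂)) {X Y Z : A} {f : X ⟶ Y} {g : Y ⟶ Z}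
    (h : IsAdmissible 𝓗 f g) (hX : IsCoresolved 𝓠 𝓗 X) (hZ : IsCoresolved 𝓠 𝓗 Z) :
    IsCoresolved 𝓠 𝓗 Y := by
  refine ⟨fun Y => ∃ (X Z : A) (f : X ⟶ Y) (g : Y ⟶ Z), IsCoresolved 𝓠 𝓗 X ∧
    IsCoresolved 𝓠 𝓗 Z ∧ IsAdmissible 𝓗 f g, ⟨X, Z, f, g, hX, hZ, h⟩, ?_⟩
  rintro Y ⟨X, Z, f, g, hX, hZ, h⟩
  obtain ⟨Q₁, X', a, p, hQ₁, hX', ha⟩ := hX.exists_admissible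
  obtain ⟨Q₂, Z', c, r, hQ₂, hZ', hc⟩ := hZ.exists_admissible
  obtain ⟨Y', b, q, f', g', hb, h'⟩ := h.horseshoe ha hc (h𝓠𝓗 _ hQ₁)
  exact ⟨_, Y', b, q, h𝓠 _ _ hQ₁ hQ₂, ⟨X', Z', f', g', hX', hZ', h'⟩, hb⟩

/-- Plain exactness suffices here: the horseshoe lifts by projectivity, and admissibility of the new
step comes from the two outer steps. -/
lemma IsResolved.of_isShortExact (h𝓟' : ∀ P, 𝓟 P → Projective P)
    (h𝓟 : ∀ P₁ P₂, 𝓟 P₁ → 𝓟 P₂ → 𝓟 (P₁ ⊞ P₂)) {X Y Z : A} {f : X ⟶ Y} {g : Y ⟶ Z}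
    (h : IsShortExact f g) (hX : IsResolved 𝓟 𝓗 X) (hZ : IsResolved 𝓟 𝓗 Z) :
    IsResolved 𝓟 𝓗 Y := by
  refine ⟨fun Y => ∃ (X Z : A) (f : X ⟶ Y) (g : Y ⟶ Z), IsResolved 𝓟 𝓗 X ∧
    IsResolved 𝓟 𝓗 Z ∧ IsShortExact f g, ⟨X, Z, f, g, hX, hZ, h⟩, ?_⟩
  rintro Y ⟨X, Z, f, g, hX, hZ, h⟩
  obtain ⟨P₁, X', a, p, hP₁, hX', ha⟩ := hX.exists_admissible
  obtain ⟨P₂, Z', c, r, hP₂, hZ', hc⟩ := hZ.exists_admissible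
  obtain ⟨Y', b, q, f', g', hb, h'⟩ := h.horseshoe ha hc (h𝓟' _ hP₂)
  exact ⟨_, Y', b, q, h𝓟 _ _ hP₁ hP₂, ⟨X', Z', f', g', hX', hZ', h'⟩, hb⟩

lemma IsCoresolved.of_biprod (h𝓠𝓗 : 𝓠 ≤ 𝓗)
    (h𝓠 : ∀ Q₁ Q₂, 𝓠 Q₁ → 𝓠 Q₂ → 𝓠 (Q₁ ⊞ Q₂)) {X Y : A}
    (h : IsCoresolved 𝓠 𝓗 (X ⊞ Y)) : IsCoresolved 𝓠 𝓗 X := by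
  refine ⟨fun X => ∃ Y, IsCoresolved 𝓠 𝓗 (X ⊞ Y), ⟨Y, h⟩, ?_⟩
  rintro X ⟨Y, h⟩
  obtain ⟨Q, Z, i, p, hQ, hZ, hip⟩ := h.exists_admissible
  have := hip.mono
  have := hip.epi
  obtain ⟨X', q, haq⟩ := IsShortExact.exists_cokernel (biprod.inl ≫ i : X ⟶ Q)
  have hinl : biprod.inl ≫ i ≫ q = 0 := by simpa using haq.zero
  have : Epi q := haq.epi
  obtain ⟨p', hp'⟩ := haq.exists_desc p (by simp [hip.zero])
  have : Epi p' := by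
    have : Epi (q ≫ p') := by rw [hp']; infer_instance
    exact epi_of_epi q p'
  -- The complement of the new cokernel `X'` is `X` itself; the sequence is the sum of `0 → Y → X' →
  -- Z → 0` and the identity of `X`.
  refine ⟨Q, _, biprod.inl ≫ i, q, hQ, ⟨X, IsCoresolved.of_isAdmissible h𝓠𝓗 h𝓠
    (f := biprod.lift (biprod.snd ≫ biprod.inr ≫ i ≫ q) biprod.fst) (g := biprod.fst ≫ p')
    ⟨.of_desc ?_ ?_ inferInstance ?_, fun {H} hH t => ?_⟩ h hZ⟩, haq, fun {H} hH t => ?_⟩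
  · simp [hp', hip.zero]
  · refine Preadditive.mono_of_cancel_zero _ fun t ht => ?_
    have h1 : t ≫ biprod.fst = 0 := by simpa using ht =≫ biprod.snd
    have h2 : (t ≫ biprod.snd ≫ biprod.inr ≫ i) ≫ q = 0 := by simpa using ht =≫ biprod.fst
    obtain ⟨s, hs⟩ := haq.exists_lift _ h2
    have h3 : s ≫ biprod.inl = t ≫ biprod.snd ≫ biprod.inr := by
      rw [← cancel_mono i]; simpa using hs
    have h4 : t ≫ biprod.snd = 0 := by simpa using (h3 =≫ biprod.snd).symm
    ext <;> simp [h1, h4]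
  · intro T t ht
    have h1 : biprod.inr ≫ t = 0 := by
      simpa [biprod.lift_eq] using biprod.inl ≫= ht
    have h2 : biprod.inr ≫ i ≫ q ≫ biprod.inl ≫ t = 0 := by
      simpa [biprod.lift_eq, reassoc_of% h1] using biprod.inr ≫= ht
    obtain ⟨s, hs⟩ := hip.exists_desc (q ≫ biprod.inl ≫ t) (by
      ext
      · simp [reassoc_of% hinl]
      · simpa using h2)
    refine ⟨s, ?_⟩
    ext
    · rw [← cancel_epi q]
      simpa [reassoc_of% hp'] using hs
    · simp [h1]
  · obtain ⟨k, hk⟩ := hip.exists_extension hH (biprod.snd ≫ biprod.inr ≫ t)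
    obtain ⟨l, hl⟩ := haq.exists_desc k (by simp [hk])
    refine ⟨biprod.desc l (biprod.inl ≫ t), ?_⟩
    ext
    · simp
    · simp [hl, hk]
  · obtain ⟨k, hk⟩ := hip.exists_extension hH (biprod.fst ≫ t)
    exact ⟨k, by simp [hk]⟩

lemma IsResolved.of_biprod (h𝓟' : ∀ P, 𝓟 P → Projective P)
    (h𝓟 : ∀ P₁ P₂, 𝓟 P₁ → 𝓟 P₂ → 𝓟 (P₁ ⊞ P₂)) {X Y : A}
    (h : IsResolved 𝓟 𝓗 (X ⊞ Y)) : IsResolved 𝓟 𝓗 X := by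
  refine ⟨fun X => ∃ Y, IsResolved 𝓟 𝓗 (X ⊞ Y), ⟨Y, h⟩, ?_⟩
  rintro X ⟨Y, h⟩
  obtain ⟨P, K, i, p, hP, hK, hip⟩ := h.exists_admissible
  have := hip.mono
  have := hip.epi
  obtain ⟨X', b, hbq⟩ := IsShortExact.exists_kernel (p ≫ biprod.fst : P ⟶ X)
  have hfst : b ≫ p ≫ biprod.fst = 0 := hbq.zero
  have : Mono b := hbq.mono
  obtain ⟨i', hi'⟩ := hbq.exists_lift i (by simp [reassoc_of% hip.zero])
  have : Mono i' := by
    have : Mono (i' ≫ b) := by rw [hi']; infer_instance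
    exact mono_of_mono i' b
  -- The sum of `0 → K → X' → Y → 0` and the identity of `X`.
  have hex : IsShortExact (i' ≫ biprod.inl : K ⟶ X' ⊞ X)
      (biprod.desc (b ≫ p ≫ biprod.snd ≫ biprod.inr) biprod.inl : X' ⊞ X ⟶ X ⊞ Y) := by
    refine .of_lift ?_ inferInstance ?_ ?_
    · simp [reassoc_of% hi', reassoc_of% hip.zero]
    · refine Preadditive.epi_of_cancel_zero _ fun t ht => ?_
      have h1 : biprod.inl ≫ t = 0 := by simpa using biprod.inr ≫= ht
      have h2 : b ≫ p ≫ biprod.snd ≫ biprod.inr ≫ t = 0 := by simpa using biprod.inl ≫= ht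
      obtain ⟨s, hs⟩ := hbq.exists_desc _ h2
      have h3 : biprod.fst ≫ s = biprod.snd ≫ biprod.inr ≫ t := by
        rw [← cancel_epi p]; simpa using hs
      have h4 : biprod.inr ≫ t = 0 := by simpa using (biprod.inr ≫= h3).symm
      ext <;> simp [h1, h4]
    · intro T t ht
      have h1 : t ≫ biprod.snd = 0 := by
        simpa [biprod.desc_eq, hfst] using ht =≫ biprod.fst
      have h2 : t ≫ biprod.fst ≫ b ≫ p ≫ biprod.snd = 0 := by
        simpa [biprod.desc_eq] using ht =≫ biprod.snd
      obtain ⟨s, hs⟩ := hip.exists_lift (t ≫ biprod.fst ≫ b) (by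
        ext
        · simp [hfst]
        · simpa using h2)
      refine ⟨s, ?_⟩
      ext
      · rw [← cancel_mono b]
        simpa [hi'] using hs
      · simp [h1]
  refine ⟨P, X', b, p ≫ biprod.fst, hP, ⟨X, IsResolved.of_isShortExact h𝓟' h𝓟 hex hK h⟩,
    hbq, fun {H} hH t => ?_⟩
  -- `k` agrees with `t` only on `K`; the error factors through `X'/K ≅ Y` and is corrected via `P →
  -- Y`.
  obtain ⟨k, hk⟩ := hip.exists_extension hH (i' ≫ t)
  obtain ⟨s, hs⟩ := hex.exists_desc (biprod.fst ≫ (t - b ≫ k)) (by simp [reassoc_of% hi', hk])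
  refine ⟨k + p ≫ biprod.snd ≫ biprod.inr ≫ s, ?_⟩
  have h1 := biprod.inl ≫= hs
  simp only [biprod.inl_desc_assoc, biprod.inl_fst_assoc, Category.assoc] at h1
  rw [Preadditive.comp_add, h1, add_sub_cancel]

end Abelian

/-! ### Coproducts of relative resolutions and coresolutions. -/

section Coproducts

variable {A : Type*} [Category* A] [Abelian A] {J : Type*} [HasColimitsOfShape (Discrete J) A]
  [HasExactColimitsOfShape (Discrete J) A] {𝓟 𝓠 𝓗 : ObjectProperty A}

lemma mono_sigmaMap {X Y : J → A} (f : ∀ j, X j ⟶ Y j) (hf : ∀ j, Mono (f j)) :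
    Mono (Limits.Sigma.map f) := by
  have : Mono (Discrete.natTrans (F := Discrete.functor X) (G := Discrete.functor Y)
      fun j => f j.as) := by
    have : ∀ j, Mono ((Discrete.natTrans (F := Discrete.functor X) (G := Discrete.functor Y)
      fun j => f j.as).app j) := fun j => hf j.as
    exact NatTrans.mono_of_mono_app _
  exact inferInstanceAs (Mono (colim.map (Discrete.natTrans (F := Discrete.functor X)
    (G := Discrete.functor Y) fun j => f j.as)))

lemma IsShortExact.sigma {X Y Z : J → A} {f : ∀ j, X j ⟶ Y j} {g : ∀ j, Y j ⟶ Z j}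
    (h : ∀ j, IsShortExact (f j) (g j)) : IsShortExact (Limits.Sigma.map f) (Limits.Sigma.map g) := by
  have := fun j => (h j).epi
  refine .of_desc ?_ (mono_sigmaMap f fun j => (h j).mono) inferInstance fun {T} t ht => ?_
  · ext j
    simp [reassoc_of% (h j).zero]
  · choose s hs using fun j => (h j).exists_desc (Sigma.ι Y j ≫ t) (by
      simpa using Sigma.ι X j ≫= ht)
    exact ⟨Sigma.desc s, by ext j; simp [hs]⟩

lemma IsAdmissible.sigma {X Y Z : J → A} {f : ∀ j, X j ⟶ Y j} {g : ∀ j, Y j ⟶ Z j}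
    (h : ∀ j, IsAdmissible 𝓗 (f j) (g j)) : IsAdmissible 𝓗 (Limits.Sigma.map f) (Limits.Sigma.map g) where
  toIsShortExact := .sigma fun j => (h j).toIsShortExact
  exists_extension {H} hH t := by
    choose s hs using fun j => (h j).exists_extension hH (Sigma.ι X j ≫ t)
    exact ⟨Sigma.desc s, by ext j; simp [hs]⟩

lemma IsCoresolved.sigma (h𝓠 : ∀ Q : J → A, (∀ j, 𝓠 (Q j)) → 𝓠 (∐ Q)) {X : J → A}
    (h : ∀ j, IsCoresolved 𝓠 𝓗 (X j)) : IsCoresolved 𝓠 𝓗 (∐ X) := by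
  refine ⟨fun Y => ∃ X : J → A, (∀ j, IsCoresolved 𝓠 𝓗 (X j)) ∧ ∐ X = Y, ⟨X, h, rfl⟩, ?_⟩
  rintro _ ⟨X, h, rfl⟩
  choose Q Z f g hQ hZ hfg using fun j => (h j).exists_admissible
  exact ⟨∐ Q, ∐ Z, _, _, h𝓠 Q hQ, ⟨Z, hZ, rfl⟩, .sigma hfg⟩

lemma IsResolved.sigma (h𝓟 : ∀ P : J → A, (∀ j, 𝓟 (P j)) → 𝓟 (∐ P)) {X : J → A}
    (h : ∀ j, IsResolved 𝓟 𝓗 (X j)) : IsResolved 𝓟 𝓗 (∐ X) := by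
  refine ⟨fun Y => ∃ X : J → A, (∀ j, IsResolved 𝓟 𝓗 (X j)) ∧ ∐ X = Y, ⟨X, h, rfl⟩, ?_⟩
  rintro _ ⟨X, h, rfl⟩
  choose P K f g hP hK hfg using fun j => (h j).exists_admissible
  exact ⟨∐ P, ∐ K, _, _, h𝓟 P hP, ⟨K, hK, rfl⟩, .sigma hfg⟩

end Coproducts

/-! ### Cutting exact complexes into short exact sequences and gluing them back. -/

section Splicing

variable {A : Type*} [Category* A] [Abelian A]

/-- A presentation of a complex as a splicing of short exact sequences
`0 ⟶ Z (i + 1) ⟶ E.X (i + 1) ⟶ Z i ⟶ 0`. -/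
structure Splicing (E : ChainComplex A ℤ) where
  /-- The outer terms of the short exact sequences. -/
  Z : ℤ → A
  /-- The inclusion of `Z i`. -/
  ι : ∀ i, Z i ⟶ E.X i
  /-- The projection onto `Z i`. -/
  π : ∀ i, E.X (i + 1) ⟶ Z i
  fac : ∀ i, π i ≫ ι i = E.d (i + 1) i
  isShortExact : ∀ i, IsShortExact (ι (i + 1)) (π i)

lemma epi_toCycles {E : ChainComplex A ℤ} (hE : E.Acyclic) (i : ℤ) :
    Epi (E.toCycles (i + 1) i) := by
  have hex := hE i
  rw [HomologicalComplex.exactAt_iff' E (i + 1) i (i - 1) (by simp) (by simp)] at hex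
  have h := E.toCycles_cyclesIsoSc'_hom (i + 1) i (i - 1) (by simp) (by simp)
  have := hex.epi_toCycles
  rw [← h] at this
  exact (epi_comp_iff_of_isIso _ _).1 this

namespace Splicing

/-- An acyclic complex is spliced from its cycles. -/
noncomputable def ofAcyclic {E : ChainComplex A ℤ} (hE : E.Acyclic) : Splicing E where
  Z i := E.cycles i
  ι i := E.iCycles i
  π i := E.toCycles (i + 1) i
  fac i := E.toCycles_i (i + 1) i
  isShortExact i := by
    refine .of_lift ?_ inferInstance (epi_toCycles hE i) fun {T} t ht => ?_
    · rw [← cancel_mono (E.iCycles i)]; simp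
    · exact ⟨E.liftCycles t i (by simp) (by simpa using ht =≫ E.iCycles i), by simp⟩

lemma acyclic {E : ChainComplex A ℤ} (s : Splicing E) : E.Acyclic := fun i => by
  obtain ⟨j, rfl⟩ : ∃ j, i = j + 1 := ⟨i - 1, by simp⟩
  rw [HomologicalComplex.exactAt_iff' E (j + 1 + 1) (j + 1) j (by simp) (by simp),
    ShortComplex.exact_iff_exact_up_to_refinements]
  intro T (x : T ⟶ E.X (j + 1)) (hx : x ≫ E.d (j + 1) j = 0)
  have := (s.isShortExact j).epi
  have := (s.isShortExact (j + 1)).epi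
  have : Mono (s.ι j) := by
    obtain ⟨k, rfl⟩ : ∃ k, j = k + 1 := ⟨j - 1, by simp⟩
    exact (s.isShortExact k).mono
  obtain ⟨y, hy⟩ := (s.isShortExact j).exists_lift x (by
    rw [← cancel_mono (s.ι j), Category.assoc, s.fac, zero_comp, hx])
  refine ⟨pullback (s.π (j + 1)) y, pullback.snd _ _, inferInstance, pullback.fst _ _, ?_⟩
  change _ = _ ≫ E.d (j + 1 + 1) (j + 1)
  rw [← s.fac, pullback.condition_assoc, hy]
  rfl

variable {E : ChainComplex A ℤ} (s : Splicing E)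

lemma mono_ι (i : ℤ) : Mono (s.ι i) := by
  obtain ⟨k, rfl⟩ : ∃ k, i = k + 1 := ⟨i - 1, by simp⟩
  exact (s.isShortExact k).mono

lemma nonempty_iso_cycles (i : ℤ) : Nonempty (s.Z i ≅ E.cycles i) := by
  have hd : s.ι i ≫ E.d i (i - 1) = 0 := by
    obtain ⟨k, rfl⟩ : ∃ k, i = k + 1 := ⟨i - 1, by simp⟩
    rw [add_sub_cancel_right, ← s.fac, reassoc_of% (s.isShortExact k).zero, zero_comp]
  let φ := E.liftCycles (s.ι i) (i - 1) (by simp) hd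
  have hφ : φ ≫ E.iCycles i = s.ι i := by simp [φ]
  have : Mono φ := by
    have : Mono (φ ≫ E.iCycles i) := by rw [hφ]; exact s.mono_ι i
    exact mono_of_mono φ (E.iCycles i)
  have : Epi φ := by
    have : s.π i ≫ φ = E.toCycles (i + 1) i := by
      rw [← cancel_mono (E.iCycles i), Category.assoc, hφ, s.fac]; simp
    have : Epi (s.π i ≫ φ) := by rw [this]; exact epi_toCycles s.acyclic i
    exact epi_of_epi (s.π i) φ
  have := isIso_of_mono_of_epi φ
  exact ⟨asIso φ⟩

lemma nonempty_iso_image {i j : ℤ} (hij : i = j + 1) : Nonempty (s.Z j ≅ image (E.d i j)) := by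
  subst hij
  have := (s.isShortExact j).epi
  have := s.mono_ι j
  have := strongEpi_of_epi (s.π j)
  exact ⟨image.isoStrongEpiMono (s.π j) (s.ι j) (s.fac j)⟩

/-- A map to `H` killed by the incoming differential is a map from the next outer term, and it comes
from the next differential exactly when it extends along the inclusion of that term. -/
lemma isHomExact_iff (𝓗 : ObjectProperty A) :
    IsHomExact 𝓗 E ↔ ∀ i, IsAdmissible 𝓗 (s.ι (i + 1)) (s.π i) := by
  have := fun i => s.mono_ι i
  have := fun i => (s.isShortExact i).epi
  constructor
  · intro h i
    refine ⟨s.isShortExact i, fun {H} hH t => ?_⟩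
    have h1 := h H hH (i + 1 + 1)
    rw [add_sub_cancel_right] at h1
    obtain ⟨k, hk⟩ := (h1 (s.π (i + 1) ≫ t)).1 (by
      rw [← s.fac]; simp [reassoc_of% (s.isShortExact (i + 1)).zero])
    refine ⟨k, ?_⟩
    rw [← cancel_epi (s.π (i + 1)), ← hk, ← Category.assoc, s.fac]
  · intro h H hH i t
    obtain ⟨i, rfl⟩ : ∃ k, i = k + 1 + 1 := ⟨i - 1 - 1, by simp⟩
    rw [add_sub_cancel_right]
    constructor
    · intro ht
      obtain ⟨k, hk⟩ := (s.isShortExact (i + 1)).exists_desc t (by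
        rw [← cancel_epi (s.π (i + 1 + 1)), ← Category.assoc, s.fac, comp_zero]; exact ht)
      obtain ⟨l, hl⟩ := (h i).exists_extension hH k
      exact ⟨l, by simp [← s.fac, hl, hk]⟩
    · rintro ⟨k, rfl⟩
      simp

end Splicing

variable {𝓟 𝓠 𝓗 : ObjectProperty A}

lemma isResolved_of_isHomExact {E : ChainComplex A ℤ} (hE : E.Acyclic) (hE' : IsHomExact 𝓗 E)
    (hP : ∀ i, 0 ≤ i → 𝓟 (E.X i)) : IsResolved 𝓟 𝓗 (image (E.d 0 (-1))) := by
  let s := Splicing.ofAcyclic hE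
  have hs := (s.isHomExact_iff 𝓗).1 hE'
  refine .of_iso ⟨fun Y => ∃ i, -1 ≤ i ∧ s.Z i = Y, ⟨-1, le_rfl, rfl⟩, ?_⟩
    (s.nonempty_iso_image (i := 0) (j := -1) rfl).some
  rintro _ ⟨i, hi, rfl⟩
  exact ⟨_, _, _, _, hP (i + 1) (by lia), ⟨i + 1, by lia, rfl⟩, hs i⟩

lemma isCoresolved_of_isHomExact {E : ChainComplex A ℤ} (hE : E.Acyclic) (hE' : IsHomExact 𝓗 E)
    (hQ : ∀ i, i < 0 → 𝓠 (E.X i)) : IsCoresolved 𝓠 𝓗 (image (E.d 0 (-1))) := by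
  let s := Splicing.ofAcyclic hE
  have hs := (s.isHomExact_iff 𝓗).1 hE'
  refine .of_iso ⟨fun Y => ∃ i, i < 0 ∧ s.Z i = Y, ⟨-1, by lia, rfl⟩, ?_⟩
    (s.nonempty_iso_image (i := 0) (j := -1) rfl).some
  rintro _ ⟨i, hi, rfl⟩
  obtain ⟨j, rfl⟩ : ∃ j, i = j + 1 := ⟨i - 1, by simp⟩
  exact ⟨_, _, _, _, hQ (j + 1) hi, ⟨j, by lia, rfl⟩, hs j⟩

/-- Iterated choice of steps gives syzygies `k n` and cosyzygies `c n`; since `k 0` and `c 0` are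
both `X`, the two halves are glued there. -/
lemma exists_isHomExact {X : A} (hX : IsResolved 𝓟 𝓗 X) (hX' : IsCoresolved 𝓠 𝓗 X) :
    ∃ E : ChainComplex A ℤ, E.Acyclic ∧ IsHomExact 𝓗 E ∧ (∀ i, 0 ≤ i → 𝓟 (E.X i)) ∧
      (∀ i, i < 0 → 𝓠 (E.X i)) ∧ Nonempty (X ≅ image (E.d 0 (-1))) := by
  choose P K f g hP hK hfg using
    fun Y : Subtype (IsResolved 𝓟 𝓗) => Y.2.exists_admissible
  choose Q C a b hQ hC hab using
    fun Y : Subtype (IsCoresolved 𝓠 𝓗) => Y.2.exists_admissible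
  let k : ℕ → Subtype (IsResolved 𝓟 𝓗) :=
    fun n => n.rec ⟨X, hX⟩ fun _ Y => ⟨K Y, hK Y⟩
  let c : ℕ → Subtype (IsCoresolved 𝓠 𝓗) :=
    fun n => n.rec ⟨X, hX'⟩ fun _ Y => ⟨C Y, hC Y⟩
  let T : ℤ → A
    -- `negSucc n` is degree `-(n + 1)`, so `X = c 0` is the outer term `Z (-1)` and the gluing map
    -- goes from degree `0` to degree `-1`.
    | .ofNat n => P (k n)
    | .negSucc n => Q (c n)
  let Z : ℤ → A
    | .ofNat n => (k (n + 1)).1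
    | .negSucc n => (c n).1
  let ι : ∀ i, Z i ⟶ T i
    | .ofNat n => f (k n)
    | .negSucc n => a (c n)
  let π : ∀ i, T (i + 1) ⟶ Z i
    | .ofNat n => g (k (n + 1))
    | .negSucc 0 => g (k 0)
    | .negSucc (n + 1) => b (c n)
  have h : ∀ i, IsAdmissible 𝓗 (ι (i + 1)) (π i)
    | .ofNat n => hfg (k (n + 1))
    | .negSucc 0 => hfg (k 0)
    | .negSucc (n + 1) => hab (c n)
  let E : ChainComplex A ℤ := ChainComplex.of T (fun i => π i ≫ ι i)
    fun i => by simp [reassoc_of% (h i).zero]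
  let s : Splicing E :=
    { Z := Z, ι := ι, π := π, fac i := (ChainComplex.of_d T (fun i => π i ≫ ι i) i).symm,
      isShortExact i := (h i).toIsShortExact }
  have hZ : s.Z (-1) = X := rfl
  refine ⟨E, s.acyclic, (s.isHomExact_iff 𝓗).2 h, ?_, ?_,
    hZ ▸ s.nonempty_iso_image (i := 0) (j := -1) rfl⟩
  · rintro (n | n) hn
    · exact hP (k n)
    · lia
  · rintro (n | n) hn
    · lia
    · exact hQ (c n)

end Splicing

/-! ### Splicings under isomorphism and coproduct; projective complexes. -/

section

variable {A : Type*} [Category* A] [Abelian A]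

lemma IsShortExact.of_iso_middle {X Y Y' Z : A} {f : X ⟶ Y} {g : Y ⟶ Z} (h : IsShortExact f g)
    (e : Y ≅ Y') : IsShortExact (f ≫ e.hom) (e.inv ≫ g) :=
  have := h.mono
  have := h.epi
  .of_desc (by simp [h.zero]) inferInstance inferInstance fun t ht => by
    obtain ⟨s, hs⟩ := h.exists_desc (e.hom ≫ t) (by simpa using ht)
    exact ⟨s, by simp [hs]⟩

/-- Transport of a splicing along an isomorphism of complexes. -/
noncomputable def Splicing.ofIso {E E' : ChainComplex A ℤ} (s : Splicing E) (e : E ≅ E') :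
    Splicing E' where
  Z := s.Z
  ι i := s.ι i ≫ e.hom.f i
  π i := e.inv.f (i + 1) ≫ s.π i
  fac i := by
    simp only [Category.assoc]
    rw [reassoc_of% (s.fac i), ← e.hom.comm, ← HomologicalComplex.comp_f_assoc, e.inv_hom_id,
      HomologicalComplex.id_f, Category.id_comp]
  isShortExact i :=
    (s.isShortExact i).of_iso_middle ((HomologicalComplex.eval _ _ (i + 1)).mapIso e)

/-- The coproduct of splicings. -/
noncomputable def Splicing.sigma {J : Type*} [HasColimitsOfShape (Discrete J) A]
    [HasExactColimitsOfShape (Discrete J) A] {E : J → ChainComplex A ℤ}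
    (s : ∀ j, Splicing (E j)) : Splicing (∐ E) :=
  let e (i : ℤ) : ∐ (fun j => (E j).X i) ≅ (∐ E).X i :=
    (PreservesCoproduct.iso (HomologicalComplex.eval A _ i) E).symm
  have he (i : ℤ) (j : J) :
      Sigma.ι (fun j => (E j).X i) j ≫ (e i).hom = (Sigma.ι E j).f i :=
    ι_comp_sigmaComparison (HomologicalComplex.eval A _ i) E j
  { Z i := ∐ fun j => (s j).Z i
    ι i := Limits.Sigma.map (fun j => (s j).ι i) ≫ (e i).hom
    π i := (e (i + 1)).inv ≫ Limits.Sigma.map (fun j => (s j).π i)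
    fac i := by
      rw [← cancel_epi (e (i + 1)).hom]
      ext j
      simp [he, reassoc_of% he, reassoc_of% (s j).fac]
    isShortExact i :=
      (IsShortExact.sigma fun j => (s j).isShortExact i).of_iso_middle (e (i + 1)) }

/-- An acyclic complex with projective cycles is a projective object. -/
lemma Splicing.projective {E : ChainComplex A ℤ} (s : Splicing E)
    (hs : ∀ i, Projective (s.Z i)) : Projective E := by
  have := fun i => (s.isShortExact i).epi
  have hρ : ∀ i, ∃ ρ : E.X i ⟶ s.Z i, s.ι i ≫ ρ = 𝟙 _ := fun i => by
    obtain ⟨j, rfl⟩ : ∃ j, i = j + 1 := ⟨i - 1, by simp⟩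
    exact ⟨_, ((s.isShortExact j).shortExact.splittingOfProjective).f_r⟩
  -- Retractions `ρ` and the matching sections `σ` split every short exact piece, so `E` is
  -- contractible.
  choose ρ hρ using hρ
  choose σ hσ using fun i => (s.isShortExact i).exists_desc
    (𝟙 _ - ρ (i + 1) ≫ s.ι (i + 1)) (by simp [reassoc_of% hρ])
  refine ⟨fun {M N} f e _ => ?_⟩
  choose g hg using fun i => Projective.factors (σ i ≫ f.f (i + 1)) (e.f (i + 1))
  -- The contraction `ρ ≫ σ` followed by `f`, lifted degreewise through `e`. The lift `d t + t d` is
  -- automatically a chain map and composes with `e` to `f`, as the contraction gives the identity.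
  let t : ∀ i j, (ComplexShape.down ℤ).Rel j i → (E.X i ⟶ M.X j) :=
    fun i j (h : i + 1 = j) => ρ i ≫ g i ≫ eqToHom (by rw [h])
  refine ⟨Homotopy.nullHomotopicMap' t, ?_⟩
  ext i
  obtain ⟨j, rfl⟩ : ∃ j, i = j + 1 := ⟨i - 1, by simp⟩
  rw [HomologicalComplex.comp_f, Homotopy.nullHomotopicMap'_f
    (show (ComplexShape.down ℤ).Rel (j + 1 + 1) (j + 1) from rfl)
    (show (ComplexShape.down ℤ).Rel (j + 1) j from rfl) t]
  have h1 : (E.d (j + 1) j ≫ t j (j + 1) rfl) ≫ e.f (j + 1) =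
      s.π j ≫ σ j ≫ f.f (j + 1) := by
    simp [t, ← s.fac, reassoc_of% hρ, hg]
  have h2 : (t (j + 1) (j + 1 + 1) rfl ≫ M.d (j + 1 + 1) (j + 1)) ≫ e.f (j + 1) =
      ρ (j + 1) ≫ s.ι (j + 1) ≫ f.f (j + 1) := by
    have h3 : σ (j + 1) ≫ E.d (j + 1 + 1) (j + 1) = s.ι (j + 1) := by
      rw [← cancel_epi (s.π (j + 1)), reassoc_of% hσ, ← s.fac]
      simp [reassoc_of% (s.isShortExact (j + 1)).zero]
    simp only [t, eqToHom_refl, Category.comp_id, Category.assoc]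
    rw [← e.comm, reassoc_of% hg, f.comm, reassoc_of% h3]
  rw [Preadditive.add_comp, h1, h2, reassoc_of% hσ]
  simp

end

/-! ### Closure properties of the tilde classes over `R`, and the two-sided characterization. -/

section

variable {R : Type u} [CommRing R] {𝒳 : ObjectProperty (ModuleCat.{u} R)}

lemma tilde_of_splicing [𝒳.IsClosedUnderIsomorphisms] {E : Ch R} (s : Splicing E)
    (hs : ∀ i, 𝒳 (s.Z i)) : tilde 𝒳 E :=
  ⟨s.acyclic, fun i => 𝒳.prop_of_iso (s.nonempty_iso_cycles i).some (hs i)⟩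

lemma tilde_of_iso [𝒳.IsClosedUnderIsomorphisms] {E E' : Ch R} (e : E ≅ E')
    (h : tilde 𝒳 E) : tilde 𝒳 E' :=
  tilde_of_splicing ((Splicing.ofAcyclic h.1).ofIso e) h.2

lemma tilde_sigma [𝒳.IsClosedUnderIsomorphisms]
    (h𝒳 : ∀ (J : Type u) (M : J → ModuleCat.{u} R), (∀ j, 𝒳 (M j)) → 𝒳 (∐ M))
    {J : Type u} {E : J → Ch R} (h : ∀ j, tilde 𝒳 (E j)) : tilde 𝒳 (∐ E) :=
  tilde_of_splicing (Splicing.sigma fun j => .ofAcyclic (h j).1)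
    fun i => h𝒳 J _ fun j => (h j).2 i

lemma tilde_biprod [𝒳.IsClosedUnderIsomorphisms]
    (h𝒳 : ∀ (J : Type u) (M : J → ModuleCat.{u} R), (∀ j, 𝒳 (M j)) → 𝒳 (∐ M))
    {E E' : Ch R} (h : tilde 𝒳 E) (h' : tilde 𝒳 E') : tilde 𝒳 (E ⊞ E') := by
  -- A biproduct is a coproduct over a two-element type, lifted to the universe of the coproduct
  -- hypothesis.
  let F : ULift.{u} Bool → Ch R := fun b => bif b.down then E else E'
  let e : ∐ F ≅ E ⊞ E' :=
    { hom := Sigma.desc fun | ⟨true⟩ => biprod.inl | ⟨false⟩ => biprod.inr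
      inv := biprod.desc (Sigma.ι F ⟨true⟩) (Sigma.ι F ⟨false⟩)
      hom_inv_id := by
        ext1 ⟨b⟩
        cases b <;> simp
      inv_hom_id := by apply biprod.hom_ext' <;> simp <;> rfl }
  exact tilde_of_iso e (tilde_sigma h𝒳 fun | ⟨true⟩ => h | ⟨false⟩ => h')

instance : (projectiveModules R).IsClosedUnderIsomorphisms where
  of_iso {X _} e (h : Module.Projective R X) := h.of_equiv' e.toLinearEquiv

instance (C : ModuleCat.{u} R) : (cProjectiveModules C).IsClosedUnderIsomorphisms where
  of_iso := by
    rintro _ _ e ⟨P, hP, ⟨i⟩⟩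
    exact ⟨P, hP, ⟨e.toLinearEquiv.symm ≪≫ₗ i⟩⟩

lemma projectiveModules_sigma {J : Type u} (M : J → ModuleCat.{u} R)
    (h : ∀ j, projectiveModules R (M j)) : projectiveModules R (∐ M) := by
  classical
  have : ∀ j, Module.Projective R (M j) := h
  exact Module.Projective.of_equiv' (ModuleCat.coprodIsoDirectSum M).toLinearEquiv.symm

lemma cProjectiveModules_sigma (C : ModuleCat.{u} R) {J : Type u} (M : J → ModuleCat.{u} R)
    (h : ∀ j, cProjectiveModules C (M j)) : cProjectiveModules C (∐ M) := by
  classical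
  choose P hP e using h
  exact ⟨ModuleCat.of R (DirectSum J fun j => P j), Module.Projective.directSum,
    ⟨(ModuleCat.coprodIsoDirectSum M).toLinearEquiv ≪≫ₗ
      DFinsupp.mapRange.linearEquiv (fun j => (e j).some) ≪≫ₗ
      (TensorProduct.directSumRight R R C fun j => P j).symm⟩⟩

lemma cProjectiveModules_le (C : ModuleCat.{u} R) : cProjectiveModules C ≤ cFlatModules C := by
  rintro M ⟨P, hP, e⟩
  exact ⟨P, Module.Flat.of_projective, e⟩

lemma projective_of_tilde {E : Ch R} (h : tilde (projectiveModules R) E) : Projective E :=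
  (Splicing.ofAcyclic h.1).projective fun i =>
    (IsProjective.iff_projective (E.cycles i)).1 (h.2 i)

lemma isDCProjective_iff (C : ModuleCat.{u} R) (X : Ch R) :
    IsDCProjective C X ↔
      IsResolved (tilde (projectiveModules R)) (tilde (cFlatModules C)) X ∧
      IsCoresolved (tilde (cProjectiveModules C)) (tilde (cFlatModules C)) X := by
  constructor
  · rintro ⟨E, hE, hE', hP, hQ, ⟨e⟩⟩
    exact ⟨(isResolved_of_isHomExact hE hE' hP).of_iso e.symm,
      (isCoresolved_of_isHomExact hE hE' hQ).of_iso e.symm⟩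
  · rintro ⟨h, h'⟩
    exact exists_isHomExact h h'

end

end DingComplex

theorem corollary2p11 {R : Type u} [CommRing R] (C : ModuleCat.{u} R)
    (hC : DingComplex.IsSemidualizing C) :
    (∀ X A B : DingComplex.Ch R, DingComplex.IsDCProjective C X → Nonempty (X ≅ A ⊞ B) →
      DingComplex.IsDCProjective C A) ∧
    (∀ (Λ : Type u) (X : Λ → DingComplex.Ch R),
      (∀ l, DingComplex.IsDCProjective C (X l)) → DingComplex.IsDCProjective C (∐ X)) := by
  simp only [DingComplex.isDCProjective_iff]
  refine ⟨fun X A B ⟨h, h'⟩ ⟨e⟩ => ⟨?_, ?_⟩, fun Λ X h => ⟨?_, ?_⟩⟩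
  · exact (h.of_iso e).of_biprod (fun _ => DingComplex.projective_of_tilde)
      fun _ _ => DingComplex.tilde_biprod fun _ => DingComplex.projectiveModules_sigma
  · exact (h'.of_iso e).of_biprod
      (fun E hE => ⟨hE.1, fun i => DingComplex.cProjectiveModules_le C _ (hE.2 i)⟩)
      fun _ _ => DingComplex.tilde_biprod fun _ => DingComplex.cProjectiveModules_sigma C
  · exact .sigma (fun _ => DingComplex.tilde_sigma fun _ => DingComplex.projectiveModules_sigma)
      fun l => (h l).1
  · exact .sigma
      (fun _ => DingComplex.tilde_sigma fun _ => DingComplex.cProjectiveModules_sigma C)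
      fun l => (h l).2
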